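/- Let all graphs be finite and simple, and let embeddings in the real projective plane $\mathbb{RP}^2$ be piecewise linear. The faces of an embedded graph are the connected components of its complement. A graph is \emph{outer-projective-planar} if it has an embedding in $\mathbb{RP}^2$ with all its vertices on the boundary of a single face, and \emph{nonouter-projective-planar} otherwise. A graph $G$ is \emph{strongly nonseparating} if it has an embedding in $\mathbb{RP}^2$ such that any two distinct vertices $u,v$ of $G$ are joined by a path in $\mathbb{RP}^2$ that meets the embedded graph only at its end points, and \emph{weakly separating} otherwise. A graph is \emph{minor-minimally} $P$ if it has the property $P$ but no proper minor of it has $P$; here a minor of $G$ is a graph obtained from $G$ by deleting vertices, deleting edges and contracting edges, and it is proper if it is not isomorphic to $G$. Theorem. If $G$ is strongly nonseparating and minor-minimally nonouter-projective-planar, then the disjoint union $G\,\dot\cup\,K_1$ of $G$ with a single vertex embeds in $\mathbb{RP}^2$ and is minor-minimally weakly separating; in particular every proper minor of $G\,\dot\cup\,K_1$ is strongly nonseparating. -/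

import Mathlib

/-! ### The real projective plane -/

/-- The real projective plane: the lines through the origin of `ℝ³`. -/
def RP2 : Type := Projectivization ℝ (Fin 3 → ℝ)

namespace RP2

/-- The point of the projective plane with homogeneous coordinates `z`. -/
noncomputable def mk (z : Fin 3 → ℝ) (hz : z ≠ 0) : RP2 := Projectivization.mk ℝ z hz

/-- The quotient topology from `ℝ³ ∖ {0}`. -/
noncomputable instance : TopologicalSpace RP2 :=
  TopologicalSpace.coinduced (fun z : {z : Fin 3 → ℝ // z ≠ 0} => mk z.1 z.2) inferInstance

/-- A straight segment in the projective plane: the image of a segment of `ℝ³` that misses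
the origin. (It is a point if the end points of that segment are proportional, and otherwise a
proper closed subarc of a projective line.) -/
def IsSegment (S : Set RP2) : Prop :=
  ∃ a b : Fin 3 → ℝ, (0 : Fin 3 → ℝ) ∉ segment ℝ a b ∧
    S = {x | ∃ z ∈ segment ℝ a b, ∃ hz : z ≠ 0, x = mk z hz}

/-- `S` is a simple piecewise linear arc from `x` to `y`: the image of an injective path from
`x` to `y` that is a union of finitely many straight segments. -/
def IsPLArc (x y : RP2) (S : Set RP2) : Prop :=
  (∃ γ : Path x y, Function.Injective γ ∧ Set.range γ = S) ∧
    ∃ 𝒮 : Set (Set RP2), 𝒮.Finite ∧ (∀ s ∈ 𝒮, IsSegment s) ∧ S = ⋃₀ 𝒮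

end RP2

namespace SimpleGraph

universe u v

/-! ### Minors -/

/-- `H` is a minor of `G`: there are pairwise disjoint nonempty connected sets of vertices of `G`
(the branch sets, which are contracted to the vertices of `H`) such that every edge of `H` is
realized by an edge of `G` between the corresponding branch sets. -/
def IsMinor {W : Type v} {V : Type u} (H : SimpleGraph W) (G : SimpleGraph V) : Prop :=
  ∃ B : W → Set V,
    (∀ a, (G.induce (B a)).Connected) ∧
    (∀ a b, a ≠ b → Disjoint (B a) (B b)) ∧
    (∀ a b, H.Adj a b → ∃ x ∈ B a, ∃ y ∈ B b, G.Adj x y)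

/-- A proper minor of `G`: a minor that is not isomorphic to `G`. For a finite graph `G` these are
the graphs obtained from `G` by at least one deletion of a vertex or an edge or contraction of
an edge. -/
def IsProperMinor {W : Type v} {V : Type u} (H : SimpleGraph W) (G : SimpleGraph V) : Prop :=
  H.IsMinor G ∧ IsEmpty (H ≃g G)

/-- `G` has the property `P`, but no proper minor of `G` has it. -/
def MinorMinimal (P : ∀ ⦃W : Type u⦄, SimpleGraph W → Prop) {V : Type u}
    (G : SimpleGraph V) : Prop :=
  P G ∧ ∀ (W : Type u) (H : SimpleGraph W), H.IsProperMinor G → ¬ P H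

/-! ### Graphs in the projective plane -/

/-- A piecewise linear embedding of `G` in the projective plane. -/
structure ProjectiveDrawing {V : Type u} (G : SimpleGraph V) where
  /-- the points that represent the vertices -/
  pt : V → RP2
  /-- the arcs that represent the edges (the values off the edge set play no role) -/
  arc : Sym2 V → Set RP2
  pt_injective : Function.Injective pt
  isPLArc : ∀ a b, G.Adj a b → RP2.IsPLArc (pt a) (pt b) (arc s(a, b))
  /-- an edge passes through no vertex other than its two ends -/
  mem_of_pt_mem_arc : ∀ e ∈ G.edgeSet, ∀ w, pt w ∈ arc e → w ∈ e
  /-- distinct edges meet only in common ends -/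
  inter_arc : ∀ e ∈ G.edgeSet, ∀ f ∈ G.edgeSet, e ≠ f →
    ∀ x ∈ arc e ∩ arc f, ∃ w, w ∈ e ∧ w ∈ f ∧ x = pt w

namespace ProjectiveDrawing

variable {V : Type u} {G : SimpleGraph V}

/-- The point set of the drawing: all its vertices and edges. -/
def support (D : ProjectiveDrawing G) : Set RP2 :=
  Set.range D.pt ∪ ⋃ e ∈ G.edgeSet, D.arc e

/-- The faces of a drawing: the connected components of its complement. -/
def IsFace (D : ProjectiveDrawing G) (F : Set RP2) : Prop :=
  ∃ x ∈ D.supportᶜ, F = connectedComponentIn D.supportᶜ x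

end ProjectiveDrawing

/-- `G` embeds in the projective plane. -/
def ProjectivePlanar {V : Type u} (G : SimpleGraph V) : Prop :=
  Nonempty (ProjectiveDrawing G)

/-- `G` embeds in the projective plane with all its vertices on the boundary of one face. -/
def OuterProjectivePlanar {V : Type u} (G : SimpleGraph V) : Prop :=
  ∃ (D : ProjectiveDrawing G) (F : Set RP2), D.IsFace F ∧ ∀ w, D.pt w ∈ frontier F

/-- `G` embeds in the projective plane so that any two vertices are joined by a path in the
projective plane that meets the drawing only at its end points. -/
def StronglyNonseparating {V : Type u} (G : SimpleGraph V) : Prop :=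
  ∃ D : ProjectiveDrawing G, ∀ a b : V, a ≠ b →
    ∃ γ : _root_.Path (D.pt a) (D.pt b), ∀ t : unitInterval, 0 < t → t < 1 → γ t ∉ D.support

/-- The negation of being strongly nonseparating. -/
def WeaklySeparating {V : Type u} (G : SimpleGraph V) : Prop :=
  ¬ StronglyNonseparating G

/-- The negation of being outer-projective-planar. -/
def NonouterProjectivePlanar {V : Type u} (G : SimpleGraph V) : Prop :=
  ¬ OuterProjectivePlanar G

end SimpleGraph

/-!
A disjoint union `G ⊔ K₁` is strongly nonseparating only if `G` is outer-projective-planar: in a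
drawing of `G ⊔ K₁` the isolated vertex lies in a face of the drawing of `G`, and the paths from it
to the vertices of `G` run in that face and so put all the vertices on its boundary
(`StronglyNonseparating.outerProjectivePlanar_of_sum`).

Conversely, outer-projective-planar graphs are strongly nonseparating
(`OuterProjectivePlanar.stronglyNonseparating`), and they stay outer-projective-planar when an
isolated vertex is added (`OuterProjectivePlanar.sum_completeGraph_one`). A proper minor of
`G ⊔ K₁` is `G` itself, a proper minor of `G`, or the disjoint union of a proper minor of `G` with
`K₁` (`IsMinor.of_sum`); the first is strongly nonseparating by hypothesis, the others because
proper minors of `G` are outer-projective-planar.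

The topology behind this is local. The lift to `ℝ³` of a segment is a polyhedral double cone, hence
conical at each of its points, so that a point in the closure of a face of a piecewise linear
drawing is reached from that face along a straight path (`RP2.exists_path_of_mem_closure`); faces
are open and connected, hence path-connected. When an isolated vertex is added in a face, the
punctured face is still connected (`RP2.isPreconnected_diff_singleton`), so it is a face of the new
drawing. Finitely many segments never cover the projective plane
(`RP2.exists_notMem_sUnion`), so that `G ⊔ K₁` can be drawn whenever `G` can.
-/

namespace RP2

open Topology Filter Set

/-! ### Segments as polyhedral cones -/

lemma mk_eq_mk_iff {z w : Fin 3 → ℝ} {hz : z ≠ 0} {hw : w ≠ 0} :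
    mk z hz = mk w hw ↔ ∃ c : ℝ, c • w = z :=
  Projectivization.mk_eq_mk_iff' ℝ z w hz hw

lemma exists_eq_mk (x : RP2) : ∃ z, ∃ hz : z ≠ 0, x = mk z hz :=
  ⟨Projectivization.rep x, Projectivization.rep_nonzero x, (Projectivization.mk_rep x).symm⟩

/-- The closed convex cone spanned by two vectors. -/
def cone (a b : Fin 3 → ℝ) : Set (Fin 3 → ℝ) :=
  {z | ∃ s t : ℝ, 0 ≤ s ∧ 0 ≤ t ∧ z = s • a + t • b}

/-- `S` is the set of the lines that meet a segment from `a` to `b`, so a vector is on one of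
these lines if and only if it lies in the double cone over that segment. -/
lemma IsSegment.exists_cone {S : Set RP2} (hS : IsSegment S) :
    ∃ a b : Fin 3 → ℝ, (0 : Fin 3 → ℝ) ∉ segment ℝ a b ∧
      ∀ z (hz : z ≠ 0), mk z hz ∈ S ↔ z ∈ cone a b ∨ -z ∈ cone a b := by
  obtain ⟨a, b, h0, rfl⟩ := hS
  refine ⟨a, b, h0, fun z hz => ?_⟩
  -- a nonzero vector of the cone is a positive multiple of a vector of the segment
  have key : ∀ w, w ≠ 0 → w ∈ cone a b → ∃ y ∈ segment ℝ a b, ∃ c : ℝ, c • y = w := by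
    rintro w hw ⟨s, t, hs, ht, rfl⟩
    have hst : 0 < s + t := by
      rcases (add_nonneg hs ht).lt_or_eq with h | h
      · exact h
      · obtain rfl : s = 0 := by linarith
        obtain rfl : t = 0 := by linarith
        simp at hw
    refine ⟨(s / (s + t)) • a + (t / (s + t)) • b,
      ⟨_, _, by positivity, by positivity, by field_simp, rfl⟩, s + t, ?_⟩
    rw [smul_add, smul_smul, smul_smul, mul_div_cancel₀ _ hst.ne', mul_div_cancel₀ _ hst.ne']
  constructor
  · rintro ⟨y, ⟨s, t, hs, ht, -, rfl⟩, hy, h⟩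
    obtain ⟨c, rfl⟩ := mk_eq_mk_iff.1 h
    rcases le_total 0 c with hc | hc
    · exact Or.inl ⟨c * s, c * t, by positivity, by positivity, by module⟩
    · exact Or.inr ⟨-c * s, -c * t, mul_nonneg (by linarith) hs, mul_nonneg (by linarith) ht,
        by module⟩
  · rintro (h | h)
    · obtain ⟨y, hy, c, rfl⟩ := key z hz h
      exact ⟨y, hy, fun h => h0 (h ▸ hy), mk_eq_mk_iff.2 ⟨c, rfl⟩⟩
    · obtain ⟨y, hy, c, hc⟩ := key (-z) (neg_ne_zero.2 hz) h
      exact ⟨y, hy, fun h => h0 (h ▸ hy), mk_eq_mk_iff.2 ⟨-c, by rw [neg_smul, hc, neg_neg]⟩⟩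

/-- A cone spanned by linearly independent vectors is cut out by finitely many linear
inequalities: in a basis that extends the given vectors, their coordinates are nonnegative and the
other ones vanish. -/
lemma exists_finite_dual_of_linearIndependent {ι : Type} [Fintype ι] {v : ι → Fin 3 → ℝ}
    (hv : LinearIndependent ℝ v) :
    ∃ L : Set ((Fin 3 → ℝ) →ₗ[ℝ] ℝ), L.Finite ∧
      ∀ z, (∀ ℓ ∈ L, 0 ≤ ℓ z) ↔ ∃ c : ι → ℝ, (∀ i, 0 ≤ c i) ∧ z = ∑ i, c i • v i := by
  classical
  let b := Module.Basis.sumExtend hv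
  have hb : ∀ i, b (Sum.inl i) = v i := fun i => by
    simp [b, Module.Basis.sumExtend]
    rfl
  have : Fintype (ι ⊕ Module.Basis.sumExtendIndex hv) := FiniteDimensional.fintypeBasisIndex b
  have : Fintype (Module.Basis.sumExtendIndex hv) :=
    Fintype.ofInjective (Sum.inr : _ → ι ⊕ Module.Basis.sumExtendIndex hv) Sum.inr_injective
  refine ⟨range b.coord ∪ range (fun j => -b.coord (Sum.inr j)),
    (finite_range _).union (finite_range _), fun z => ⟨fun h => ?_, ?_⟩⟩
  · have h1 : ∀ k, 0 ≤ b.repr z k := fun k => h (b.coord k) (Or.inl ⟨k, rfl⟩)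
    have h2 : ∀ j, b.repr z (Sum.inr j) = 0 := fun j =>
      le_antisymm (by simpa using h (-b.coord (Sum.inr j)) (Or.inr ⟨j, rfl⟩)) (h1 _)
    refine ⟨fun i => b.repr z (Sum.inl i), fun i => h1 _, ?_⟩
    conv_lhs => rw [← b.sum_repr z]
    rw [← Finset.sum_subset (Finset.subset_univ (Finset.univ.map Function.Embedding.inl))]
    · simp [hb]
    · rintro (i | j) - hk
      · simp at hk
      · simp [h2]
  · rintro ⟨c, hc, rfl⟩ ℓ (⟨k, rfl⟩ | ⟨j, rfl⟩)
    · simp only [← hb, map_sum, map_smul, Module.Basis.coord_apply, Module.Basis.repr_self,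
        smul_eq_mul]
      refine Finset.sum_nonneg fun i _ => mul_nonneg (hc i) ?_
      rw [Finsupp.single_apply]; split_ifs <;> norm_num
    · simp [← hb]

/-- The cone over a segment that misses the origin is polyhedral. -/
lemma exists_finite_dual_cone {a b : Fin 3 → ℝ} (h0 : (0 : Fin 3 → ℝ) ∉ segment ℝ a b) :
    ∃ L : Set ((Fin 3 → ℝ) →ₗ[ℝ] ℝ), L.Finite ∧ ∀ z, z ∈ cone a b ↔ ∀ ℓ ∈ L, 0 ≤ ℓ z := by
  by_cases h : LinearIndependent ℝ ![a, b]
  · obtain ⟨L, hL, H⟩ := exists_finite_dual_of_linearIndependent h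
    refine ⟨L, hL, fun z => Iff.trans ⟨?_, ?_⟩ (H z).symm⟩
    · rintro ⟨s, t, hs, ht, rfl⟩
      exact ⟨![s, t], by simp [Fin.forall_fin_two, hs, ht], by simp⟩
    · rintro ⟨c, hc, rfl⟩
      exact ⟨c 0, c 1, hc 0, hc 1, by simp⟩
  · have ha : a ≠ 0 := fun h => h0 (h ▸ left_mem_segment ℝ a b)
    rw [LinearIndependent.pair_iff' ha] at h
    push Not at h
    obtain ⟨k, rfl⟩ := h
    -- the two end points are positively proportional, so that the cone is a ray
    have hk : 0 ≤ k := by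
      by_contra! hk
      refine h0 ⟨-k / (1 - k), 1 / (1 - k), div_nonneg (by linarith) (by linarith),
        div_nonneg (by linarith) (by linarith), ?_, ?_⟩
      · rw [← add_div, div_eq_one_iff_eq] <;> linarith
      · rw [smul_smul, ← add_smul]; ring_nf; simp
    obtain ⟨L, hL, H⟩ := exists_finite_dual_of_linearIndependent
      (v := fun _ : Unit => a) (linearIndependent_unique_iff.2 ha)
    refine ⟨L, hL, fun z => Iff.trans ⟨?_, ?_⟩ (H z).symm⟩
    · rintro ⟨s, t, hs, ht, rfl⟩
      exact ⟨fun _ => s + t * k, fun _ => by positivity, by simp; module⟩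
    · rintro ⟨c, hc, rfl⟩
      exact ⟨c (), 0, hc (), le_rfl, by simp⟩

lemma IsSegment.exists_finite_dual {S : Set RP2} (hS : IsSegment S) :
    ∃ L : Set ((Fin 3 → ℝ) →ₗ[ℝ] ℝ), L.Finite ∧
      ∀ z (hz : z ≠ 0), mk z hz ∈ S ↔ (∀ ℓ ∈ L, 0 ≤ ℓ z) ∨ ∀ ℓ ∈ L, 0 ≤ ℓ (-z) := by
  obtain ⟨a, b, h0, h⟩ := hS.exists_cone
  obtain ⟨L, hL, H⟩ := exists_finite_dual_cone h0
  exact ⟨L, hL, fun z hz => by rw [h, H, H]⟩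

lemma isSegment_singleton (x : RP2) : IsSegment {x} := by
  obtain ⟨a, ha, rfl⟩ := exists_eq_mk x
  refine ⟨a, a, by simpa using ha.symm, ?_⟩
  ext y
  simp [ha]

/-- Finitely many segments do not cover the projective plane, since finitely many planes do not
cover `ℝ³`. -/
lemma exists_notMem_sUnion {𝒮 : Set (Set RP2)} (hfin : 𝒮.Finite) (hseg : ∀ s ∈ 𝒮, IsSegment s) :
    ∃ x, x ∉ ⋃₀ 𝒮 := by
  classical
  by_contra! hall
  choose! a b _ hab using fun s hs => (hseg s hs).exists_cone
  let P : Set RP2 → Submodule ℝ (Fin 3 → ℝ) := fun s => Submodule.span ℝ {a s, b s}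
  have hP : ∀ s, P s ≠ ⊤ := by
    intro s h
    have h1 : Module.finrank ℝ (P s) ≤ 2 :=
      (finrank_span_le_card _).trans (by
        rw [toFinset_card, ← Nat.card_eq_fintype_card]
        exact (Set.ncard_insert_le _ _).trans (by simp))
    rw [h, finrank_top] at h1
    simp at h1
  have hcov : ⋃ p ∈ insert ⊥ (hfin.toFinset.image P), (p : Set (Fin 3 → ℝ)) = univ := by
    refine eq_univ_of_forall fun z => ?_
    simp only [mem_iUnion]
    by_cases hz : z = 0
    · exact ⟨⊥, by simp, by simp [hz]⟩
    · obtain ⟨s, hs, hzs⟩ := hall (mk z hz)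
      have hc : cone (a s) (b s) ⊆ P s := by
        rintro _ ⟨p, q, -, -, rfl⟩
        exact Submodule.mem_span_pair.2 ⟨p, q, rfl⟩
      refine ⟨P s, Finset.mem_insert_of_mem (Finset.mem_image_of_mem _ (by simpa using hs)), ?_⟩
      rcases (hab s hs z hz).1 hzs with h | h
      · exact hc h
      · simpa using (P s).neg_mem (hc h)
  have := Subspace.top_mem_of_biUnion_eq_univ hcov
  rw [Finset.mem_insert, Finset.mem_image] at this
  rcases this with h | ⟨s, -, h⟩
  · exact top_ne_bot h
  · exact hP s h

/-! ### The topology of the projective plane -/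

/-- The quotient map from `ℝ³ ∖ {0}`. -/
noncomputable def proj (z : {z : Fin 3 → ℝ // z ≠ 0}) : RP2 := mk z.1 z.2

lemma isQuotientMap_proj : IsQuotientMap proj :=
  ⟨⟨rfl⟩, fun x => let ⟨z, hz, h⟩ := exists_eq_mk x; ⟨⟨z, hz⟩, h.symm⟩⟩

instance : LocallyPathConnectedSpace RP2 :=
  haveI : LocallyPathConnectedSpace {z : Fin 3 → ℝ // z ≠ 0} :=
    IsOpen.locallyPathConnectedSpace (U := {z : Fin 3 → ℝ | z ≠ 0}) isOpen_ne
  isQuotientMap_proj.locallyPathConnectedSpace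

lemma continuous_mk {X : Type*} [TopologicalSpace X] {f : X → Fin 3 → ℝ} (hf : Continuous f)
    (h : ∀ x, f x ≠ 0) : Continuous fun x => mk (f x) (h x) :=
  isQuotientMap_proj.continuous.comp (hf.subtype_mk h)

/-- A ball of `ℝ³` is mapped onto an open set: its saturation is a union of balls. -/
lemma image_ball_mem_nhds {a : Fin 3 → ℝ} (ha : a ≠ 0) {r : ℝ} (hr : 0 < r) :
    {x | ∃ v, ‖v‖ < r ∧ ∃ h : a + v ≠ 0, x = mk (a + v) h} ∈ 𝓝 (mk a ha) := by
  refine IsOpen.mem_nhds ?_ ⟨0, by simpa, by simpa, by simp⟩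
  rw [← isQuotientMap_proj.isOpen_preimage]
  have : proj ⁻¹' {x | ∃ v, ‖v‖ < r ∧ ∃ h : a + v ≠ 0, x = mk (a + v) h} =
      ⋃ c : ℝ, {z | c ≠ 0 ∧ ‖c • z.1 - a‖ < r} := by
    ext ⟨z, hz⟩
    simp only [mem_preimage, mem_ofPred_eq, mem_iUnion, proj]
    constructor
    · rintro ⟨v, hv, h, hx⟩
      obtain ⟨c, hc⟩ := mk_eq_mk_iff.1 hx.symm
      exact ⟨c, by rintro rfl; simp at hc; exact h hc.symm, by simpa [hc] using hv⟩
    · rintro ⟨c, hc, h⟩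
      exact ⟨c • z - a, h, by simp [hc, hz], (mk_eq_mk_iff.2 ⟨c, by simp⟩).symm⟩
  rw [this]
  refine isOpen_iUnion fun c => isOpen_const.and ?_
  exact isOpen_lt (by fun_prop) continuous_const

lemma IsSegment.isClosed {S : Set RP2} (hS : IsSegment S) : IsClosed S := by
  obtain ⟨L, -, h⟩ := hS.exists_finite_dual
  rw [← isQuotientMap_proj.isClosed_preimage]
  have : proj ⁻¹' S = {z | (∀ ℓ ∈ L, 0 ≤ ℓ z.1) ∨ ∀ ℓ ∈ L, 0 ≤ ℓ (-z.1)} := by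
    ext z; exact h z.1 z.2
  rw [this, ofPred_or]
  have hc : ∀ ℓ : (Fin 3 → ℝ) →ₗ[ℝ] ℝ, Continuous ℓ := fun ℓ => ℓ.continuous_of_finiteDimensional
  refine IsClosed.union ?_ ?_ <;>
  · simp only [ofPred_forall]
    exact isClosed_biInter fun ℓ _ => isClosed_le continuous_const ((hc ℓ).comp (by fun_prop))

lemma isClosed_sUnion {𝒮 : Set (Set RP2)} (hfin : 𝒮.Finite) (hseg : ∀ s ∈ 𝒮, IsSegment s) :
    IsClosed (⋃₀ 𝒮) := by
  rw [sUnion_eq_biUnion]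
  exact hfin.isClosed_biUnion fun s hs => (hseg s hs).isClosed

instance : T1Space RP2 := ⟨fun x => (isSegment_singleton x).isClosed⟩

/-- A segment is conical at each of its points: a short straight path from `a` that meets the
segment after time zero ends on it. -/
lemma IsSegment.eventually_radial {S : Set RP2} (hS : IsSegment S) (a : Fin 3 → ℝ) :
    ∀ᶠ v in 𝓝 (0 : Fin 3 → ℝ), ∀ t : ℝ, 0 < t → t ≤ 1 →
      ∀ (ht : a + t • v ≠ 0) (h1 : a + v ≠ 0), mk (a + t • v) ht ∈ S → mk (a + v) h1 ∈ S := by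
  obtain ⟨L, hL, h⟩ := hS.exists_finite_dual
  have key : ∀ ℓ : (Fin 3 → ℝ) →ₗ[ℝ] ℝ, ∀ᶠ v in 𝓝 (0 : Fin 3 → ℝ), ∀ t : ℝ, 0 < t → t ≤ 1 →
      0 ≤ ℓ (a + t • v) → 0 ≤ ℓ (a + v) := by
    intro ℓ
    rcases le_or_gt (ℓ a) 0 with ha | ha
    · refine Eventually.of_forall fun v t ht ht1 H => ?_
      simp only [map_add, map_smul, smul_eq_mul] at H ⊢
      nlinarith [mul_nonneg (sub_nonneg.2 ht1) (neg_nonneg.2 ha)]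
    · have hc : Continuous fun v => ℓ (a + v) :=
        ℓ.continuous_of_finiteDimensional.comp (by fun_prop)
      filter_upwards [hc.continuousAt.eventually (lt_mem_nhds (show 0 < ℓ (a + 0) by simpa))]
        with v hv t _ _ _ using le_of_lt hv
  have h1 := (eventually_all_finite hL).2 fun ℓ _ => key ℓ
  have h2 := (eventually_all_finite hL).2 fun ℓ _ => key (-ℓ)
  filter_upwards [h1, h2] with v hv1 hv2 t ht ht1 hz hz1
  rw [h, h]
  rintro (H | H)
  · exact Or.inl fun ℓ hℓ => hv1 ℓ hℓ t ht ht1 (H ℓ hℓ)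
  · refine Or.inr fun ℓ hℓ => ?_
    rw [map_neg]
    refine hv2 ℓ hℓ t ht ht1 ?_
    rw [LinearMap.neg_apply, ← map_neg]
    exact H ℓ hℓ

/-- A point in the closure of a face of a finite union of segments is accessible from that face:
it is joined by a straight path to a nearby point of the face. -/
lemma exists_path_of_mem_closure {𝒮 : Set (Set RP2)} (hfin : 𝒮.Finite)
    (hseg : ∀ s ∈ 𝒮, IsSegment s) {x₀ x : RP2}
    (hx : x ∈ closure (connectedComponentIn (⋃₀ 𝒮)ᶜ x₀)) :
    ∃ y, ∃ γ : _root_.Path x y, ∀ t, 0 < t → γ t ∈ connectedComponentIn (⋃₀ 𝒮)ᶜ x₀ := by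
  obtain ⟨a, ha, rfl⟩ := exists_eq_mk x
  obtain ⟨r, hr, hball⟩ := Metric.eventually_nhds_iff.1
    ((eventually_all_finite hfin).2 fun s hs => (hseg s hs).eventually_radial a)
  obtain ⟨_, ⟨v, hv, hav, rfl⟩, hyF⟩ := mem_closure_iff_nhds.1 hx _
    (image_ball_mem_nhds ha (lt_min hr (norm_pos_iff.2 ha)))
  have hvr : dist v 0 < r := by simpa using hv.trans_le (min_le_left _ _)
  have hne : ∀ t : unitInterval, a + (t : ℝ) • v ≠ 0 := by
    intro t h
    have h1 : a = -((t : ℝ) • v) := eq_neg_of_add_eq_zero_left h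
    have h2 : ‖a‖ = t * ‖v‖ := by
      conv_lhs => rw [h1]
      rw [norm_neg, norm_smul, Real.norm_of_nonneg t.2.1]
    nlinarith [hv.trans_le (min_le_right _ _), t.2.2, norm_nonneg v]
  let γ : _root_.Path (mk a ha) (mk (a + v) hav) :=
    { toFun := fun t => mk (a + (t : ℝ) • v) (hne t)
      continuous_toFun := continuous_mk (by fun_prop) hne
      source' := by simp
      target' := by simp }
  refine ⟨_, γ, fun t ht => ?_⟩
  rw [connectedComponentIn_eq hyF]
  have hpre : IsPreconnected (γ '' Ioi 0) :=
    (Set.ordConnected_Ioi.isPreconnected).image _ γ.continuous.continuousOn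
  refine hpre.subset_connectedComponentIn ⟨1, by simp, γ.target⟩ ?_ (mem_image_of_mem _ ht)
  rintro _ ⟨u, hu, rfl⟩ ⟨s, hs, hus⟩
  exact connectedComponentIn_subset _ _ hyF
    ⟨s, hs, hball hvr s hs u (by simpa using hu) u.2.2 (hne u) hav hus⟩

/-- Two points in the closure of a face of a finite union of segments are joined by a path through
that face. -/
lemma exists_path_through_face {𝒮 : Set (Set RP2)} (hfin : 𝒮.Finite)
    (hseg : ∀ s ∈ 𝒮, IsSegment s) {x₀ x y : RP2}
    (hx : x ∈ closure (connectedComponentIn (⋃₀ 𝒮)ᶜ x₀))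
    (hy : y ∈ closure (connectedComponentIn (⋃₀ 𝒮)ᶜ x₀)) :
    ∃ γ : _root_.Path x y, ∀ t, 0 < t → t < 1 → γ t ∈ connectedComponentIn (⋃₀ 𝒮)ᶜ x₀ := by
  set F := connectedComponentIn (⋃₀ 𝒮)ᶜ x₀
  obtain ⟨x', γ, hγ⟩ := exists_path_of_mem_closure hfin hseg hx
  obtain ⟨y', δ, hδ⟩ := exists_path_of_mem_closure hfin hseg hy
  have hx' : x' ∈ F := by simpa using hγ 1 (by simp)
  have hy' : y' ∈ F := by simpa using hδ 1 (by simp)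
  have hopen : IsOpen F := IsOpen.connectedComponentIn
    (isClosed_sUnion hfin hseg).isOpen_compl
  have hF : IsPathConnected F := hopen.isConnected_iff_isPathConnected.1
    ⟨⟨x', hx'⟩, isPreconnected_connectedComponentIn⟩
  obtain ⟨ε, hε⟩ := hF.joinedIn x' hx' y' hy'
  refine ⟨(γ.trans ε).trans δ.symm, fun t h0 h1 => ?_⟩
  rw [Path.trans_apply]
  split_ifs with h
  · rw [Path.trans_apply]
    split_ifs with h'
    · exact hγ _ (by rw [← Subtype.coe_lt_coe]; simpa using h0)
    · exact hε _
  · rw [Path.symm_apply]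
    refine hδ _ ?_
    have h1' : (t : ℝ) < 1 := h1
    rw [← Subtype.coe_lt_coe]
    simp
    linarith

/-! ### Puncturing a face -/

/-- Each neighbourhood of `p` contains one that stays connected when `p` is removed: the image of a
ball of `ℝ³` minus a line, which is a codimension two subspace. -/
lemma exists_nhds_diff_singleton_isConnected {p : RP2} {U : Set RP2} (hU : U ∈ 𝓝 p) :
    ∃ N ∈ 𝓝 p, N ⊆ U ∧ IsConnected (N \ {p}) := by
  obtain ⟨a, ha, rfl⟩ := exists_eq_mk p
  have hU' : proj ⁻¹' U ∈ 𝓝 (⟨a, ha⟩ : {z : Fin 3 → ℝ // z ≠ 0}) :=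
    isQuotientMap_proj.continuous.continuousAt hU
  obtain ⟨r₀, hr₀, hball⟩ := Metric.mem_nhds_iff.1 hU'
  set r := min r₀ ‖a‖
  have hr : 0 < r := lt_min hr₀ (norm_pos_iff.2 ha)
  have hne : ∀ v : Fin 3 → ℝ, ‖v‖ < r → a + v ≠ 0 := by
    intro v hv h
    rw [← neg_eq_of_add_eq_zero_right h, norm_neg] at hv
    exact (hv.trans_le (min_le_right _ _)).false
  refine ⟨_, image_ball_mem_nhds ha hr, ?_, ?_⟩
  · rintro _ ⟨v, hv, h, rfl⟩
    exact hball (show (⟨a + v, h⟩ : {z : Fin 3 → ℝ // z ≠ 0}) ∈ Metric.ball _ r₀ by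
      simpa [Subtype.dist_eq] using hv.trans_le (min_le_left _ _))
  -- the map `v ↦ (r / (1 + ‖v‖)) • v` carries `ℝ³` onto the ball and preserves lines
  let f : (Fin 3 → ℝ) → (Fin 3 → ℝ) := fun v => (r / (1 + ‖v‖)) • v
  have hfc : Continuous f := by
    refine Continuous.smul (continuous_const.div (continuous_const.add continuous_norm) fun v => ?_) continuous_id
    exact (by positivity : 1 + ‖v‖ ≠ 0)
  have hf : ∀ v, ‖f v‖ < r := by
    intro v
    rw [norm_smul, Real.norm_of_nonneg (by positivity), div_mul_eq_mul_div, div_lt_iff₀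
      (by positivity)]
    nlinarith [norm_nonneg v]
  have hg : Continuous fun v => mk (a + f v) (hne _ (hf v)) := continuous_mk (by fun_prop) _
  have hconn : IsConnected ((Submodule.span ℝ {a} : Set (Fin 3 → ℝ))ᶜ) := by
    refine isConnected_compl_of_one_lt_codim ?_
    have h1 := Submodule.finrank_quotient_add_finrank (Submodule.span ℝ {a})
    rw [finrank_span_singleton ha] at h1
    simp at h1
    rw [← Module.finrank_eq_rank]
    norm_cast
    omega
  have hline : ∀ v h, mk (a + v) h = mk a ha ↔ v ∈ Submodule.span ℝ {a} := by
    intro v h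
    rw [mk_eq_mk_iff, Submodule.mem_span_singleton]
    exact ⟨fun ⟨c, hc⟩ => ⟨c - 1, by rw [sub_smul, hc]; simp⟩,
      fun ⟨c, hc⟩ => ⟨1 + c, by rw [add_smul, hc, one_smul]⟩⟩
  convert! hconn.image _ hg.continuousOn using 1
  ext x
  constructor
  · rintro ⟨⟨v, hv, h, rfl⟩, hx⟩
    rw [mem_singleton_iff, hline] at hx
    have hrv : 0 < r - ‖v‖ := sub_pos.2 hv
    have hfv : f ((r - ‖v‖)⁻¹ • v) = v := by
      simp only [f]
      rw [norm_smul, norm_inv, Real.norm_of_nonneg hrv.le, smul_smul]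
      convert! one_smul ℝ v
      field_simp
      ring
    refine ⟨(r - ‖v‖)⁻¹ • v, fun h => hx ?_, by simp only [hfv]⟩
    exact (Submodule.smul_mem_iff _ (inv_ne_zero hrv.ne')).1 h
  · rintro ⟨v, hv, rfl⟩
    refine ⟨⟨f v, hf v, _, rfl⟩, ?_⟩
    rw [mem_singleton_iff, hline]
    exact fun h => hv ((Submodule.smul_mem_iff _ (by positivity)).1 h)

/-- A connected open set of the projective plane stays connected when a point is removed. -/
lemma isPreconnected_diff_singleton {F : Set RP2} (hF : IsOpen F) (hc : IsPreconnected F)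
    {p : RP2} (hp : p ∈ F) : IsPreconnected (F \ {p}) := by
  obtain ⟨N, hN, hNF, hconn⟩ := exists_nhds_diff_singleton_isConnected (hF.mem_nhds hp)
  have hFp : IsOpen (F \ {p}) := hF.sdiff isClosed_singleton
  rw [isPreconnected_iff_subset_of_disjoint]
  -- if `F \ {p}` is split into two open parts, then `p` may be added to the one that contains
  -- the punctured neighbourhood
  have key : ∀ u v : Set RP2, IsOpen u → IsOpen v → F \ {p} ⊆ u ∪ v →
      F \ {p} ∩ (u ∩ v) = ∅ → N \ {p} ⊆ u → F \ {p} ⊆ u ∨ F \ {p} ⊆ v := by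
    intro u v hu hv huv hd hNu
    have h := isPreconnected_iff_subset_of_disjoint.1 hc (u ∪ interior N) (v ∩ (F \ {p}))
      (hu.union isOpen_interior) (hv.inter hFp) ?_ ?_
    · rcases h with h | h
      · refine Or.inl fun x hx => (h hx.1).elim id fun hxN => hNu ⟨interior_subset hxN, hx.2⟩
      · exact absurd rfl (h hp).2.2
    · intro x hx
      by_cases hxp : x = p
      · exact Or.inl (Or.inr (hxp ▸ mem_interior_iff_mem_nhds.2 hN))
      · exact (huv ⟨hx, hxp⟩).elim (fun h => Or.inl (Or.inl h)) fun h => Or.inr ⟨h, hx, hxp⟩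
    · rw [eq_empty_iff_forall_notMem] at hd ⊢
      rintro x ⟨-, hxu, hxv, hxF⟩
      exact hd x ⟨hxF, hxu.elim id fun h => hNu ⟨interior_subset h, hxF.2⟩, hxv⟩
  intro u v hu hv huv hd
  have hNF' : N \ {p} ⊆ F \ {p} := sdiff_subset_sdiff_left hNF
  rcases isPreconnected_iff_subset_of_disjoint.1 hconn.isPreconnected u v hu hv
    (hNF'.trans huv) (subset_eq_empty (inter_subset_inter_left _ hNF') hd) with h | h
  · exact key u v hu hv huv hd h
  · exact (key v u hv hu (union_comm u v ▸ huv) (inter_comm u v ▸ hd) h).symm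

lemma mem_closure_diff_singleton_self {F : Set RP2} {p : RP2} (hF : F ∈ 𝓝 p) :
    p ∈ closure (F \ {p}) := by
  refine mem_closure_iff_nhds.2 fun U hU => ?_
  obtain ⟨N, -, hN, hc⟩ := exists_nhds_diff_singleton_isConnected (inter_mem hU hF)
  obtain ⟨x, hx⟩ := hc.nonempty
  exact ⟨x, (hN hx.1).1, (hN hx.1).2, hx.2⟩

end RP2

namespace SimpleGraph

open Set

universe u v

namespace ProjectiveDrawing

/-! ### Drawings -/

variable {V W : Type*} {G : SimpleGraph V} {H : SimpleGraph W}

lemma notMem_support_iff (D : ProjectiveDrawing G) {x : RP2} :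
    x ∉ D.support ↔ (∀ v, x ≠ D.pt v) ∧ ∀ e ∈ G.edgeSet, x ∉ D.arc e := by
  simp [support, eq_comm]

/-- The support of a drawing of a finite graph is a finite union of segments. -/
lemma exists_support_eq_sUnion [Finite V] (D : ProjectiveDrawing G) :
    ∃ 𝒮 : Set (Set RP2), 𝒮.Finite ∧ (∀ s ∈ 𝒮, RP2.IsSegment s) ∧ D.support = ⋃₀ 𝒮 := by
  have h : ∀ e ∈ G.edgeSet, ∃ 𝒮 : Set (Set RP2), 𝒮.Finite ∧ (∀ s ∈ 𝒮, RP2.IsSegment s) ∧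
      D.arc e = ⋃₀ 𝒮 := by
    intro e
    induction e with
    | h a b => exact fun hab => (D.isPLArc a b hab).2
  choose! 𝒮 hfin hseg heq using h
  refine ⟨range (fun v => {D.pt v}) ∪ ⋃ e ∈ G.edgeSet, 𝒮 e,
    (finite_range _).union (G.edgeSet.toFinite.biUnion hfin), ?_, ?_⟩
  · rintro s (⟨v, rfl⟩ | hs)
    · exact RP2.isSegment_singleton _
    · simp only [mem_iUnion] at hs
      obtain ⟨e, he, hs⟩ := hs
      exact hseg e he s hs
  · rw [support, sUnion_union, sUnion_range, iUnion_singleton_eq_range, sUnion_iUnion]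
    congr 1
    refine iUnion_congr fun e => ?_
    rw [sUnion_iUnion]
    exact iUnion_congr fun he => heq e he

/-- The drawing of `G` obtained from a drawing of `H` and an injective homomorphism `G → H`. -/
def comap (D : ProjectiveDrawing H) (f : G →g H) (hf : Function.Injective f) :
    ProjectiveDrawing G where
  pt v := D.pt (f v)
  arc e := D.arc (e.map f)
  pt_injective := D.pt_injective.comp hf
  isPLArc a b h := D.isPLArc _ _ (f.map_adj h)
  mem_of_pt_mem_arc e he w hw := by
    have := D.mem_of_pt_mem_arc _ (f.map_mem_edgeSet he) _ hw
    obtain ⟨v, hv, h⟩ := Sym2.mem_map.1 this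
    exact hf h ▸ hv
  inter_arc e he e' he' hne x hx := by
    obtain ⟨w, hw, hw', rfl⟩ := D.inter_arc _ (f.map_mem_edgeSet he) _ (f.map_mem_edgeSet he')
      (fun h => hne (Sym2.map.injective hf h)) x hx
    obtain ⟨v, hv, rfl⟩ := Sym2.mem_map.1 hw
    obtain ⟨v', hv', h⟩ := Sym2.mem_map.1 hw'
    exact ⟨v, hv, hf h ▸ hv', rfl⟩

lemma support_comap_subset (D : ProjectiveDrawing H) (f : G →g H) (hf : Function.Injective f) :
    (D.comap f hf).support ⊆ D.support := by
  rintro x (⟨v, rfl⟩ | hx)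
  · exact Or.inl ⟨f v, rfl⟩
  · simp only [mem_iUnion] at hx
    obtain ⟨e, he, hx⟩ := hx
    exact Or.inr (mem_biUnion (f.map_mem_edgeSet he) hx)

lemma support_comap_iso (D : ProjectiveDrawing H) (f : G ≃g H) :
    (D.comap f.toHom f.injective).support = D.support := by
  refine (D.support_comap_subset _ _).antisymm ?_
  rintro x (⟨v, rfl⟩ | hx)
  · exact Or.inl ⟨f.symm v, by simp [comap]⟩
  · simp only [mem_iUnion] at hx
    obtain ⟨e, he, hx⟩ := hx
    refine Or.inr (mem_biUnion (f.symm.toHom.map_mem_edgeSet he) ?_)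
    have : (e.map f.symm).map f = e := by
      rw [Sym2.map_map]
      simp
    change x ∈ D.arc ((e.map f.symm).map f)
    rwa [this]

/-- Extension of a drawing by one isolated vertex, drawn at a point `p` off the drawing. The arc of
an edge `e` of the disjoint union is that of the one edge of `G` that is mapped to `e`. -/
def addPoint (D : ProjectiveDrawing G) (p : RP2) (hp : p ∉ D.support) :
    ProjectiveDrawing (G ⊕g completeGraph (Fin 1)) where
  pt := Sum.elim D.pt fun _ => p
  arc e := ⋃ e' ∈ {e' : Sym2 V | e'.map Sum.inl = e}, D.arc e'
  pt_injective := by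
    rw [notMem_support_iff] at hp
    rintro (a | a) (b | b) h
    · exact congrArg _ (D.pt_injective h)
    · exact absurd h.symm (hp.1 a)
    · exact absurd h (hp.1 b)
    · rw [Subsingleton.elim a b]
  isPLArc := by
    rintro (a | a) (b | b) h
    · have : {e' : Sym2 V | e'.map Sum.inl = s(Sum.inl a, (Sum.inl b : V ⊕ Fin 1))} = {s(a, b)} := by
        ext e'
        exact (Sym2.map.injective Sum.inl_injective).eq_iff (b := s(a, b))
      rw [this, biUnion_singleton]
      exact D.isPLArc a b h
    · exact absurd h (by simp)
    · exact absurd h (by simp)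
    · exact absurd (Subsingleton.elim a b) (by simpa using h)
  mem_of_pt_mem_arc := by
    intro e he w hw
    simp only [mem_iUnion] at hw
    obtain ⟨e', rfl, hw⟩ := hw
    have he' : e' ∈ G.edgeSet := by
      induction e' with
      | h a b => exact he
    rcases w with w | w
    · exact Sym2.mem_map.2 ⟨w, D.mem_of_pt_mem_arc e' he' w hw, rfl⟩
    · exact absurd hw ((notMem_support_iff D).1 hp |>.2 e' he')
  inter_arc := by
    rintro e he f hf hne x ⟨hxe, hxf⟩
    simp only [mem_iUnion] at hxe hxf
    obtain ⟨e', rfl, hxe⟩ := hxe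
    obtain ⟨f', rfl, hxf⟩ := hxf
    have he' : e' ∈ G.edgeSet := by
      induction e' with
      | h a b => exact he
    have hf' : f' ∈ G.edgeSet := by
      induction f' with
      | h a b => exact hf
    obtain ⟨w, h1, h2, rfl⟩ := D.inter_arc e' he' f' hf' (fun h => hne (h ▸ rfl)) x ⟨hxe, hxf⟩
    exact ⟨Sum.inl w, Sym2.mem_map.2 ⟨w, h1, rfl⟩, Sym2.mem_map.2 ⟨w, h2, rfl⟩, rfl⟩

lemma support_addPoint (D : ProjectiveDrawing G) (p : RP2) (hp : p ∉ D.support) :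
    (D.addPoint p hp).support = insert p D.support := by
  ext x
  constructor
  · rintro (⟨v | v, rfl⟩ | hx)
    · exact Or.inr (Or.inl ⟨v, rfl⟩)
    · exact Or.inl rfl
    · simp only [mem_iUnion] at hx
      obtain ⟨e, he, hx⟩ := hx
      simp only [addPoint, mem_iUnion] at hx
      obtain ⟨e', rfl, hx⟩ := hx
      refine Or.inr (Or.inr (mem_biUnion ?_ hx))
      induction e' with
      | h a b => exact he
  · rintro (rfl | ⟨v, rfl⟩ | hx)
    · exact Or.inl ⟨Sum.inr 0, rfl⟩
    · exact Or.inl ⟨Sum.inl v, rfl⟩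
    · simp only [mem_iUnion] at hx
      obtain ⟨e, he, hx⟩ := hx
      have he' : e.map Sum.inl ∈ (G ⊕g completeGraph (Fin 1)).edgeSet := by
        induction e with
        | h a b => exact he
      refine Or.inr (mem_biUnion he' ?_)
      simp only [addPoint, mem_iUnion]
      exact ⟨e, rfl, hx⟩

lemma IsFace.isOpen [Finite V] {D : ProjectiveDrawing G} {F : Set RP2} (hF : D.IsFace F) :
    IsOpen F := by
  obtain ⟨𝒮, hfin, hseg, h⟩ := D.exists_support_eq_sUnion
  obtain ⟨x, -, rfl⟩ := hF
  refine IsOpen.connectedComponentIn ?_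
  rw [h]
  exact (RP2.isClosed_sUnion hfin hseg).isOpen_compl

lemma IsFace.subset_compl_support {D : ProjectiveDrawing G} {F : Set RP2} (hF : D.IsFace F) :
    F ⊆ D.supportᶜ := by
  obtain ⟨x, -, rfl⟩ := hF
  exact connectedComponentIn_subset _ _

/-- A vertex lies on no face, so it is on the boundary of a face as soon as it is in its closure. -/
lemma IsFace.pt_mem_frontier {D : ProjectiveDrawing G} {F : Set RP2} (hF : D.IsFace F) {w : V}
    (hw : D.pt w ∈ closure F) : D.pt w ∈ frontier F :=
  ⟨hw, fun h => hF.subset_compl_support (interior_subset h) (Or.inl ⟨w, rfl⟩)⟩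

lemma exists_notMem_support [Finite V] (D : ProjectiveDrawing G) : ∃ x, x ∉ D.support := by
  obtain ⟨𝒮, hfin, hseg, h⟩ := D.exists_support_eq_sUnion
  exact h ▸ RP2.exists_notMem_sUnion hfin hseg

/-- A face that is punctured at a new vertex `p` is a face of the extended drawing. -/
lemma IsFace.diff_singleton [Finite V] {D : ProjectiveDrawing G} {F : Set RP2} (hF : D.IsFace F)
    {p : RP2} (hp : p ∈ F) (hp' : p ∉ D.support) :
    (D.addPoint p hp').IsFace (F \ {p}) := by
  have hpre : IsPreconnected F := by
    obtain ⟨x, -, rfl⟩ := hF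
    exact isPreconnected_connectedComponentIn
  obtain ⟨y, hy⟩ : (F \ {p}).Nonempty := closure_nonempty_iff.1
    ⟨p, RP2.mem_closure_diff_singleton_self (hF.isOpen.mem_nhds hp)⟩
  have hsub : F \ {p} ⊆ (D.addPoint p hp').supportᶜ := by
    rintro z ⟨hz, hzp⟩
    rw [support_addPoint]
    rintro (h | h)
    · exact hzp h
    · exact hF.subset_compl_support hz h
  refine ⟨y, hsub hy, Subset.antisymm ?_ ?_⟩
  · exact (RP2.isPreconnected_diff_singleton hF.isOpen hpre hp).subset_connectedComponentIn hy hsub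
  · intro z hz
    have hz' := connectedComponentIn_subset _ _ hz
    rw [support_addPoint] at hz hz'
    refine ⟨?_, fun h => hz' (Or.inl h)⟩
    obtain ⟨x, hx, rfl⟩ := hF
    rw [connectedComponentIn_eq hy.1]
    exact connectedComponentIn_mono y (compl_subset_compl.2 (subset_insert _ _)) hz

end ProjectiveDrawing

/-! ### Outer-projective-planar and strongly nonseparating graphs -/

variable {V : Type u} {W : Type v} {G : SimpleGraph V} {H : SimpleGraph W}

lemma OuterProjectivePlanar.of_iso (h : H.OuterProjectivePlanar) (f : G ≃g H) :
    G.OuterProjectivePlanar := by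
  obtain ⟨D, F, ⟨x, hx, rfl⟩, hD⟩ := h
  refine ⟨D.comap f.toHom f.injective, _, ⟨x, ?_, rfl⟩, fun w => ?_⟩
  · rwa [D.support_comap_iso]
  · rw [D.support_comap_iso]
    exact hD (f w)

lemma StronglyNonseparating.of_iso (h : H.StronglyNonseparating) (f : G ≃g H) :
    G.StronglyNonseparating := by
  obtain ⟨D, hD⟩ := h
  refine ⟨D.comap f.toHom f.injective, fun a b hab => ?_⟩
  rw [D.support_comap_iso]
  exact hD (f a) (f b) (f.injective.ne hab)

/-- The paths between the vertices can be drawn in the face that has all of them on its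
boundary. -/
lemma OuterProjectivePlanar.stronglyNonseparating [Finite V] (h : G.OuterProjectivePlanar) :
    G.StronglyNonseparating := by
  obtain ⟨D, F, hF, hD⟩ := h
  refine ⟨D, fun a b _ => ?_⟩
  obtain ⟨𝒮, hfin, hseg, hS⟩ := D.exists_support_eq_sUnion
  have hcompl := hF.subset_compl_support
  obtain ⟨x, -, rfl⟩ := hF
  rw [hS] at hD hcompl ⊢
  obtain ⟨γ, hγ⟩ := RP2.exists_path_through_face hfin hseg (frontier_subset_closure (hD a))
    (frontier_subset_closure (hD b))
  exact ⟨γ, fun t h0 h1 => hcompl (hγ t h0 h1)⟩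

/-- An isolated vertex can be drawn inside the face that has all the vertices on its boundary. -/
lemma OuterProjectivePlanar.sum_completeGraph_one [Finite V] (h : G.OuterProjectivePlanar) :
    (G ⊕g completeGraph (Fin 1)).OuterProjectivePlanar := by
  obtain ⟨D, F, hF, hD⟩ := h
  obtain ⟨p, hp⟩ : F.Nonempty := by
    obtain ⟨x, hx, rfl⟩ := hF
    exact ⟨x, mem_connectedComponentIn hx⟩
  have hp' : p ∉ D.support := hF.subset_compl_support hp
  have hface := hF.diff_singleton hp hp'
  refine ⟨D.addPoint p hp', F \ {p}, hface, fun w => hface.pt_mem_frontier ?_⟩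
  rcases w with w | w
  · have hne : D.pt w ∈ ({p}ᶜ : Set RP2) := fun h => hp' (Or.inl ⟨w, h⟩)
    change D.pt w ∈ closure (F \ {p})
    rw [sdiff_eq, inter_comm]
    exact isOpen_compl_singleton.inter_closure ⟨hne, frontier_subset_closure (hD w)⟩
  · exact RP2.mem_closure_diff_singleton_self (hF.isOpen.mem_nhds hp)

/-- The paths from the isolated vertex to the vertices of `G` all run in the face of the drawing of
`G` that contains the isolated vertex. -/
lemma StronglyNonseparating.outerProjectivePlanar_of_sum
    (h : (G ⊕g completeGraph (Fin 1)).StronglyNonseparating) : G.OuterProjectivePlanar := by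
  obtain ⟨D, hD⟩ := h
  let f : G ↪g G ⊕g completeGraph (Fin 1) := Embedding.sumInl
  let D' : ProjectiveDrawing G := D.comap f.toHom f.injective
  have hsub : D'.support ⊆ D.support := D.support_comap_subset _ _
  have hp : D.pt (Sum.inr 0) ∉ D'.support := by
    rw [ProjectiveDrawing.notMem_support_iff]
    refine ⟨fun v hv => absurd (D.pt_injective hv) (by simp [f]), fun e he hpe => ?_⟩
    obtain ⟨v, -, hv⟩ := Sym2.mem_map.1
      (D.mem_of_pt_mem_arc _ (f.toHom.map_mem_edgeSet he) _ hpe)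
    simp [f] at hv
  refine ⟨D', _, ⟨_, hp, rfl⟩, fun w => ProjectiveDrawing.IsFace.pt_mem_frontier ⟨_, hp, rfl⟩ ?_⟩
  obtain ⟨γ, hγ⟩ := hD (Sum.inr 0) (Sum.inl w) (by simp)
  have hmem : γ '' Iio 1 ⊆ connectedComponentIn D'.supportᶜ (D.pt (Sum.inr 0)) := by
    refine (ordConnected_Iio.isPreconnected.image _
      γ.continuous.continuousOn).subset_connectedComponentIn ⟨0, by simp, γ.source⟩ ?_
    rintro _ ⟨t, ht, rfl⟩
    rcases eq_or_ne t 0 with rfl | h0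
    · rwa [γ.source]
    · exact fun h => hγ t (unitInterval.pos_iff_ne_zero.2 h0) ht (hsub h)
  have hcl : γ 1 ∈ closure (γ '' Iio 1) :=
    image_closure_subset_closure_image γ.continuous
      ⟨1, by rw [closure_Iio' ⟨0, by simp⟩]; simp, rfl⟩
  rw [γ.target] at hcl
  exact closure_mono hmem hcl

/-! ### Minors of a disjoint union with a single vertex -/

/-- Deleting an isolated vertex and adding it again does not change a graph. -/
lemma nonempty_iso_sum_of_isolated {a : W} (ha : ∀ b, ¬ H.Adj a b) :
    Nonempty (H ≃g H.induce {a}ᶜ ⊕g completeGraph (Fin 1)) := by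
  classical
  let g : ({a}ᶜ : Set W) ⊕ Fin 1 → W := Sum.elim Subtype.val fun _ => a
  have hg : Function.Bijective g := by
    constructor
    · rintro (⟨b, hb⟩ | i) (⟨c, hc⟩ | j) h
      · simpa [g] using h
      · exact absurd h hb
      · exact absurd h.symm hc
      · rw [Subsingleton.elim i j]
    · intro b
      by_cases hb : b = a
      · exact ⟨Sum.inr 0, hb.symm⟩
      · exact ⟨Sum.inl ⟨b, hb⟩, rfl⟩
  refine ⟨Iso.symm ⟨Equiv.ofBijective g hg, ?_⟩⟩
  rintro (b | i) (c | j)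
  · simp [g]
  · simpa [g] using fun h => ha _ h.symm
  · simpa [g] using ha _
  · simp [g, Subsingleton.elim i j]

/-- A branch set that avoids the single vertex stays connected when it is seen in `G`. -/
lemma connected_induce_preimage_inl {B : Set (V ⊕ Fin 1)}
    (hB : ((G ⊕g completeGraph (Fin 1)).induce B).Connected) (h0 : Sum.inr 0 ∉ B) :
    (G.induce (Sum.inl ⁻¹' B)).Connected := by
  let g : ((Sum.inl ⁻¹' B : Set V)) → B := fun v => ⟨Sum.inl v.1, v.2⟩
  have hg : Function.Bijective g := by
    constructor
    · rintro ⟨v, hv⟩ ⟨w, hw⟩ h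
      simpa [g] using h
    · rintro ⟨v | i, hv⟩
      · exact ⟨⟨v, hv⟩, rfl⟩
      · exact absurd (Subsingleton.elim i 0 ▸ hv) h0
  let φ : G.induce (Sum.inl ⁻¹' B) ≃g (G ⊕g completeGraph (Fin 1)).induce B :=
    ⟨Equiv.ofBijective g hg, by simp [g]⟩
  exact φ.connected_iff.2 hB

/-- A branch set that contains the single vertex consists of it, since that vertex is isolated. -/
lemma eq_singleton_of_connected_induce {B : Set (V ⊕ Fin 1)}
    (hB : ((G ⊕g completeGraph (Fin 1)).induce B).Connected) (h0 : Sum.inr 0 ∈ B) :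
    B = {Sum.inr 0} := by
  refine Subset.antisymm (fun x hx => ?_) (singleton_subset_iff.2 h0)
  obtain ⟨p⟩ := hB.preconnected ⟨_, h0⟩ ⟨x, hx⟩
  cases p with
  | nil => rfl
  | @cons _ y _ h _ =>
    obtain ⟨y | i, hy⟩ := y
    · simp at h
    · simp [Subsingleton.elim i 0] at h

/-- A minor of `G ⊔ K₁` is a minor of `G`, or the disjoint union of a minor of `G` and a single
vertex. -/
lemma IsMinor.of_sum (h : H.IsMinor (G ⊕g completeGraph (Fin 1))) :
    H.IsMinor G ∨ ∃ a, (H.induce {a}ᶜ).IsMinor G ∧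
      Nonempty (H ≃g H.induce {a}ᶜ ⊕g completeGraph (Fin 1)) := by
  obtain ⟨B, hconn, hdisj, hadj⟩ := h
  have hadj' : ∀ b c, H.Adj b c → Sum.inr 0 ∉ B b → Sum.inr 0 ∉ B c →
      ∃ x ∈ Sum.inl ⁻¹' B b, ∃ y ∈ Sum.inl ⁻¹' B c, G.Adj x y := by
    intro b c hbc hb hc
    obtain ⟨x | i, hx, y | j, hy, hxy⟩ := hadj b c hbc
    · exact ⟨x, hx, y, hy, hxy⟩
    · exact absurd (Subsingleton.elim j 0 ▸ hy) hc
    · exact absurd (Subsingleton.elim i 0 ▸ hx) hb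
    · exact absurd (Subsingleton.elim i 0 ▸ hx) hb
  by_cases h : ∃ a, Sum.inr 0 ∈ B a
  · obtain ⟨a, ha⟩ := h
    have hBa := eq_singleton_of_connected_induce (hconn a) ha
    have hne : ∀ b : ({a}ᶜ : Set W), Sum.inr 0 ∉ B b := fun b hb =>
      (hdisj b a b.2).notMem_of_mem_left hb ha
    refine Or.inr ⟨a, ⟨fun b => Sum.inl ⁻¹' B b, fun b => ?_, fun b c hbc => ?_, fun b c hbc => ?_⟩,
      nonempty_iso_sum_of_isolated fun b hab => ?_⟩
    · exact connected_induce_preimage_inl (hconn b) (hne b)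
    · exact (hdisj b c fun h => hbc (Subtype.ext h)).preimage _
    · exact hadj' b c hbc (hne b) (hne c)
    · obtain ⟨x, hx, y | j, hy, hxy⟩ := hadj a b hab <;> rw [hBa, mem_singleton_iff] at hx <;>
        subst hx
      · simp at hxy
      · simp [Subsingleton.elim j 0] at hxy
  · push Not at h
    exact Or.inl ⟨fun b => Sum.inl ⁻¹' B b, fun b => connected_induce_preimage_inl (hconn b) (h b),
      fun b c hbc => (hdisj b c hbc).preimage _, fun b c hbc => hadj' b c hbc (h b) (h c)⟩

/-- A minor of a finite graph is finite, since its branch sets are nonempty and disjoint. -/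
lemma IsMinor.finite [Finite V] (h : H.IsMinor G) : Finite W := by
  obtain ⟨B, hconn, hdisj, -⟩ := h
  choose f hf using fun a => (hconn a).nonempty.elim fun x => (⟨x.1, x.2⟩ : ∃ v, v ∈ B a)
  refine Finite.of_injective f fun a b hab => ?_
  by_contra hne
  exact (hdisj a b hne).notMem_of_mem_left (hf a) (hab ▸ hf b)

end SimpleGraph

theorem mainTheorem9 {V : Type*} [Finite V] (G : SimpleGraph V)
    (hG : G.StronglyNonseparating)
    (hmin : SimpleGraph.MinorMinimal (fun _ H => H.NonouterProjectivePlanar) G) :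
    (G ⊕g SimpleGraph.completeGraph (Fin 1)).ProjectivePlanar ∧
      SimpleGraph.MinorMinimal (fun _ H => H.WeaklySeparating)
        (G ⊕g SimpleGraph.completeGraph (Fin 1)) := by
  obtain ⟨hnon, hminor⟩ := hmin
  have houter : ∀ (W : Type _) (H : SimpleGraph W), H.IsMinor G → IsEmpty (H ≃g G) →
      H.OuterProjectivePlanar := fun W H h h' => not_not.1 (hminor W H ⟨h, h'⟩)
  refine ⟨?_, fun h => hnon h.outerProjectivePlanar_of_sum, fun W H ⟨hH, hiso⟩ => not_not.2 ?_⟩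
  · obtain ⟨D, -⟩ := hG
    obtain ⟨p, hp⟩ := D.exists_notMem_support
    exact ⟨D.addPoint p hp⟩
  have := hH.finite
  rcases hH.of_sum with hH' | ⟨a, hH', ⟨φ⟩⟩
  · by_cases h : IsEmpty (H ≃g G)
    · exact (houter W H hH' h).stronglyNonseparating
    · obtain ⟨φ⟩ := not_isEmpty_iff.1 h
      exact hG.of_iso φ
  · refine ((houter _ _ hH' ⟨fun ψ => ?_⟩).sum_completeGraph_one.of_iso φ).stronglyNonseparating
    exact hiso.false (φ.trans (ψ.sumCongr SimpleGraph.Iso.refl))
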